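/- For $x\in\mathbb{R}$ put $\mathrm{Log}_2(x)=1$ if $x<e^e$ and $\mathrm{Log}_2(x)=\log\log x$ if $x\ge e^e$, and let $b_n=(n/\mathrm{Log}_2 n)^{1/2}$ for $n\ge 1$. For probability measures $\mu,\nu$ on $\mathbb{R}^d$ (with the Euclidean norm) let $$W_2(\mu,\nu)=\inf_{\gamma}\Big(\int |x-y|^2\,\gamma(dx\,dy)\Big)^{1/2},$$ the infimum being over all couplings $\gamma$ of $\mu$ and $\nu$. Write $N(m,V)$ for the Gaussian law on $\mathbb{R}^d$ with mean $m$ and positive semidefinite covariance matrix $V$ (degenerate if $V$ is singular). For a sequence $\omega=(\xi_1,\xi_2,\dots)$ in $\mathbb{R}^d$ and $n\ge 1$ put $$\hat m_n=\frac1n\sum_{i=1}^n \xi_i,\qquad \hat V_n=\frac1n\sum_{i=1}^n(\xi_i-\hat m_n)(\xi_i-\hat m_n)^{\mathsf T},\qquad \hat{\mathfrak p}_n=N(\hat m_n,\hat V_n)$$ (so $\hat{\mathfrak p}_1=\delta_{\xi_1}$). **Theorem.** There are positive numerical constants $c_\star$ and $c_\ast$ such that for every $d\ge 1$ and every $\varepsilon$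 with $0<\varepsilon\le[2(d+1)]^{-d}$ there are positive constants $K=K(\varepsilon,d)$ and $H=H(\varepsilon,d)$ with the following property. Let $m_0\in\mathbb{R}^d$, let $V_0$ be a symmetric positive definite real $d\times d$ matrix, let $\mathfrak p_0=N(m_0,V_0)$, and let $\xi_1,\xi_2,\dots$ be i.i.d. with law $\mathfrak p_0$ (the coordinates on $(\mathbb{R}^d)^\infty$ under the product law $\mathfrak p_0^\infty$). Then $$\mathbb{E}\Big[\Big(\sup_{n\ge1} b_n\,W_2(\mathfrak p_0,\hat{\mathfrak p}_n)\Big)^2\Big]\le C_2(\mathfrak p_0),\qquad \limsup_{n\to\infty} b_n\,W_2(\mathfrak p_0,\hat{\mathfrak p}_n)\le Y_2(\mathfrak p_0)\quad\text{almost surely},$$ where $$C_2(\mathfrak p_0)=\big[c_\star+b_d^2(d+1)\big]\operatorname{tr}V_0+c_\ast K\|V_0\|_F+H,$$ $$Y_2(\mathfrak p_0)=\sqrt2\,\Big\{\sigma_{\max}(V_0)+d\sqrt{K}\,\sqrt{\operatorname{tr}V_0}\Big\},$$ $\|V_0\|_F$ is the Frobenius norm of $V_0$ and $\sigma_{\max}(V_0)^2$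 is the largest eigenvalue of $V_0$. In particular the rate $b_n$ does not depend on $d$. -/

import Mathlib

open MeasureTheory ProbabilityTheory Filter
open scoped ENNReal

noncomputable section

/-- The Wasserstein distance of order `p` between two probability measures on a metric space:
the infimum over all couplings `γ` (measures on the product whose marginals are `μ` and `ν`) of
`(∫ d(x, y) ^ p dγ) ^ (1 / p)`, as an extended nonnegative real. -/
def wassersteinDist {S : Type*} [PseudoEMetricSpace S] [MeasurableSpace S]
    (p : ℝ) (μ ν : Measure S) : ℝ≥0∞ :=
  ⨅ (γ : Measure (S × S)) (_ : γ.map Prod.fst = μ ∧ γ.map Prod.snd = ν),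
    (∫⁻ z, edist z.1 z.2 ^ p ∂γ) ^ (1 / p)

/-- The truncated iterated logarithm: `1` for `x < e ^ e` and `log (log x)` for `x ≥ e ^ e`. -/
def logTwo (x : ℝ) : ℝ :=
  if x < Real.exp (Real.exp 1) then 1 else Real.log (Real.log x)

/-- The rate `b_n = (n / Log₂ n) ^ (1 / 2)`. -/
def rate (n : ℕ) : ℝ := Real.sqrt (n / logTwo n)

/-- The sample mean of the first `n` terms `ω 0, …, ω (n - 1)` of a sequence in `ℝ ^ d`. -/
def sampleMean {d : ℕ} (n : ℕ) (ω : ℕ → EuclideanSpace ℝ (Fin d)) : EuclideanSpace ℝ (Fin d) :=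
  (1 / (n : ℝ)) • ∑ i ∈ Finset.range n, ω i

/-- The sample covariance matrix (with normalization `1 / n`) of the first `n` terms of a
sequence in `ℝ ^ d`. -/
def sampleCov {d : ℕ} (n : ℕ) (ω : ℕ → EuclideanSpace ℝ (Fin d)) : Matrix (Fin d) (Fin d) ℝ :=
  Matrix.of fun k l =>
    (1 / (n : ℝ)) * ∑ i ∈ Finset.range n,
      (ω i k - sampleMean n ω k) * (ω i l - sampleMean n ω l)

/-- The plug-in Gaussian law, with mean the sample mean and covariance the sample covariance.
`multivariateGaussian m V` is the Gaussian law with mean `m` and covariance `V` for every positive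
semidefinite `V`, degenerate ones included; for `n = 1` it is the Dirac mass at `ω 0`. -/
def plugInGaussian {d : ℕ} (n : ℕ) (ω : ℕ → EuclideanSpace ℝ (Fin d)) :
    Measure (EuclideanSpace ℝ (Fin d)) :=
  multivariateGaussian (sampleMean n ω) (sampleCov n ω)

open scoped Matrix.Norms.Frobenius in
/-- The Frobenius norm of a real square matrix. -/
def frobeniusNorm {d : ℕ} (V : Matrix (Fin d) (Fin d) ℝ) : ℝ := ‖V‖

/-- The square root of the largest eigenvalue of a real symmetric matrix. -/
def sigmaMax {d : ℕ} {V : Matrix (Fin d) (Fin d) ℝ} (hV : V.IsHermitian) : ℝ :=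
  Real.sqrt (⨆ i, hV.eigenvalues i)

end

/-! Standardize the sample: `ω i = m + S (η i)` with `S = CFC.sqrt V` and `η` i.i.d. standard
Gaussian. If `T` is the square root of the sample covariance of `η`, the plug-in law is the image of
the standard Gaussian under `x ↦ m + S (sampleMean n η) + S T x`, and the true law is its image
under `x ↦ m + S x`. Using the same `x` in both is a coupling, whose cost is at most `√tr V` times a
quantity depending on `η` alone. As `1 - T² = (1 + T)(1 - T)` with `T ≥ 0`, the matrix `1 - T` is
controlled by `1 - T²`, the deviation of the sample covariance from the identity
(`norm_sub_sqrt_le`, `wassersteinDist_plugInGaussian_le`).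

That deviation is an average of centred products of coordinates, up to a product of sample means. So
`b_n W₂` is at most `√tr V` times a constant times `y + y²`, where `y` adds up finitely many
one-dimensional averages normalized by `b_n` (`rate_mul_sampleDeviation_le`).

Each such average obeys a bounded law of the iterated logarithm with moments
(`exists_bound_supNormSum`): Doob's inequality for exponentials on dyadic blocks gives summable
tails. They yield a fourth moment of the supremum, needed because `y²` gets squared, and an almost
sure bound by Borel–Cantelli. The resulting constants depend on `d` only and are absorbed in `K`. -/

/-! ### Doob's maximal inequality for exponentials of sums -/

section MaximalInequality

variable {Ω : Type*} {mΩ : MeasurableSpace Ω} {μ : Measure Ω} {X : ℕ → Ω → ℝ}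

/-- Exponentials of partial sums of independent variables with `1 ≤ E exp (l X)` form a
submartingale. -/
theorem submartingale_exp_mul_sum (hind : iIndepFun X μ) (hmeas : ∀ i, Measurable (X i)) {l : ℝ}
    (hint : ∀ i, Integrable (fun ω => Real.exp (l * X i ω)) μ) (hge : ∀ i, 1 ≤ mgf (X i) μ l) :
    Submartingale (fun n ω => Real.exp (l * ∑ i ∈ Finset.range (n + 1), X i ω))
      (Filtration.natural X fun i => (hmeas i).stronglyMeasurable) μ := by
  have : IsProbabilityMeasure μ := hind.isProbabilityMeasure
  have hint' : ∀ n, Integrable (fun ω => Real.exp (l * ∑ i ∈ Finset.range (n + 1), X i ω)) μ := by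
    intro n
    simpa using hind.integrable_exp_mul_sum hmeas (s := Finset.range (n + 1)) fun i _ => hint i
  have hadp : StronglyAdapted (Filtration.natural X fun i => (hmeas i).stronglyMeasurable)
      (fun n ω => Real.exp (l * ∑ i ∈ Finset.range (n + 1), X i ω)) := by
    intro n
    refine Real.continuous_exp.comp_stronglyMeasurable (StronglyMeasurable.const_mul ?_ l)
    refine Finset.stronglyMeasurable_fun_sum _ fun i hi => ?_
    exact ((Filtration.stronglyAdapted_natural fun i => (hmeas i).stronglyMeasurable) i).mono
      (Filtration.mono _ (by simpa [Nat.lt_succ_iff] using hi))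
  refine submartingale_nat hadp hint' fun n => ?_
  have hsplit : (fun ω => Real.exp (l * ∑ i ∈ Finset.range (n + 1 + 1), X i ω)) =
      (fun ω => Real.exp (l * ∑ i ∈ Finset.range (n + 1), X i ω)) *
        (fun ω => Real.exp (l * X (n + 1) ω)) := by
    ext ω
    simp only [Pi.mul_apply]
    rw [Finset.sum_range_succ, mul_add, Real.exp_add]
  have hpull := condExp_mul_of_stronglyMeasurable_left (μ := μ) (hadp n)
    (hsplit ▸ hint' (n + 1)) (hint (n + 1))
  have hcond : μ[fun ω => Real.exp (l * X (n + 1) ω) |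
      Filtration.natural X (fun i => (hmeas i).stronglyMeasurable) n] =ᵐ[μ]
      fun _ => mgf (X (n + 1)) μ l := by
    refine condExp_indep_eq (hmeas (n + 1)).comap_le (Filtration.le _ _) ?_
      (hind.indep_comap_natural_of_lt _ (Nat.lt_succ_self n))
    exact (Real.measurable_exp.comp
      ((comap_measurable (X (n + 1))).const_mul l)).stronglyMeasurable
  filter_upwards [hpull, hcond] with ω h1 h2
  rw [hsplit, h1, Pi.mul_apply, h2]
  exact le_mul_of_one_le_right (Real.exp_pos _).le (hge _)

/-- Doob's maximal inequality for exponentials of partial sums. -/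
theorem measure_exists_le_mul_sum_le (hind : iIndepFun X μ) (hmeas : ∀ i, Measurable (X i))
    {l B : ℝ} (hint : ∀ i, Integrable (fun ω => Real.exp (l * X i ω)) μ)
    (hge : ∀ i, 1 ≤ mgf (X i) μ l) (hle : ∀ i, mgf (X i) μ l ≤ Real.exp B) (u : ℝ) (N : ℕ) :
    μ {ω | ∃ n, 1 ≤ n ∧ n ≤ N ∧ u ≤ l * ∑ i ∈ Finset.range n, X i ω} ≤
      ENNReal.ofReal (Real.exp (N * B - u)) := by
  have : IsProbabilityMeasure μ := hind.isProbabilityMeasure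
  rcases N with _ | N
  · have : {ω | ∃ n, 1 ≤ n ∧ n ≤ 0 ∧ u ≤ l * ∑ i ∈ Finset.range n, X i ω} = ∅ := by
      ext ω
      simp only [Set.mem_ofPred_eq, Set.mem_empty_iff_false, iff_false]
      rintro ⟨n, h1, h2, -⟩
      omega
    rw [this]
    simp
  have hsub := submartingale_exp_mul_sum hind hmeas hint hge
  -- The submartingale at time `k` carries `k + 1` summands, so time `N` covers all sums of up to `N
  -- + 1` terms.
  have hmax := maximal_ineq hsub (fun n ω => (Real.exp_pos _).le)
    (ε := Real.toNNReal (Real.exp u)) N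
  rw [Real.coe_toNNReal _ (Real.exp_pos u).le] at hmax
  set A := {ω | Real.exp u ≤ (Finset.range (N + 1)).sup' Finset.nonempty_range_add_one
    fun k => Real.exp (l * ∑ i ∈ Finset.range (k + 1), X i ω)} with hA
  have hsubset : {ω | ∃ n, 1 ≤ n ∧ n ≤ N + 1 ∧ u ≤ l * ∑ i ∈ Finset.range n, X i ω} ⊆ A := by
    rintro ω ⟨n, h1, h2, h3⟩
    obtain ⟨k, rfl⟩ : ∃ k, n = k + 1 := ⟨n - 1, by omega⟩
    rw [hA, Set.mem_ofPred_eq, Finset.le_sup'_iff]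
    exact ⟨k, by simpa using h2, Real.exp_le_exp.2 h3⟩
  have hI : ∫ ω in A, Real.exp (l * ∑ i ∈ Finset.range (N + 1), X i ω) ∂μ ≤
      Real.exp ((N + 1 : ℕ) * B) := by
    refine (setIntegral_le_integral (hsub.integrable N)
      (ae_of_all _ fun ω => (Real.exp_pos _).le)).trans ?_
    have h := hind.mgf_sum hmeas (t := l) (Finset.range (N + 1))
    simp only [mgf, Finset.sum_apply] at h
    rw [h, Real.exp_nat_mul]
    refine (Finset.prod_le_prod (fun i _ => mgf_nonneg) fun i _ => hle i).trans (by simp)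
  have hmul : ENNReal.ofReal (Real.exp u) * μ A ≤ ENNReal.ofReal (Real.exp ((N + 1 : ℕ) * B)) := by
    exact le_trans hmax (ENNReal.ofReal_le_ofReal hI)
  calc _ ≤ μ A := measure_mono hsubset
    _ = ENNReal.ofReal (Real.exp (-u)) * (ENNReal.ofReal (Real.exp u) * μ A) := by
      rw [← mul_assoc, ← ENNReal.ofReal_mul (Real.exp_pos _).le, ← Real.exp_add]
      simp
    _ ≤ ENNReal.ofReal (Real.exp (-u)) * ENNReal.ofReal (Real.exp ((N + 1 : ℕ) * B)) := by gcongr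
    _ = _ := by
      rw [← ENNReal.ofReal_mul (Real.exp_pos _).le, ← Real.exp_add]
      ring_nf

/-- Two-sided version of the maximal inequality for exponentials of partial sums. -/
theorem measure_exists_le_mul_abs_sum_le (hind : iIndepFun X μ) (hmeas : ∀ i, Measurable (X i))
    {l B : ℝ} (hint : ∀ i, Integrable (fun ω => Real.exp (l * X i ω)) μ)
    (hint' : ∀ i, Integrable (fun ω => Real.exp (-l * X i ω)) μ)
    (hge : ∀ i, 1 ≤ mgf (X i) μ l) (hge' : ∀ i, 1 ≤ mgf (X i) μ (-l))
    (hle : ∀ i, mgf (X i) μ l ≤ Real.exp B) (hle' : ∀ i, mgf (X i) μ (-l) ≤ Real.exp B)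
    (u : ℝ) (N : ℕ) :
    μ {ω | ∃ n, 1 ≤ n ∧ n ≤ N ∧ u ≤ l * |∑ i ∈ Finset.range n, X i ω|} ≤
      2 * ENNReal.ofReal (Real.exp (N * B - u)) := by
  have hsubset : {ω | ∃ n, 1 ≤ n ∧ n ≤ N ∧ u ≤ l * |∑ i ∈ Finset.range n, X i ω|} ⊆
      {ω | ∃ n, 1 ≤ n ∧ n ≤ N ∧ u ≤ l * ∑ i ∈ Finset.range n, X i ω} ∪
      {ω | ∃ n, 1 ≤ n ∧ n ≤ N ∧ u ≤ -l * ∑ i ∈ Finset.range n, X i ω} := by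
    rintro ω ⟨n, h1, h2, h3⟩
    rcases abs_choice (∑ i ∈ Finset.range n, X i ω) with h | h
    · exact Or.inl ⟨n, h1, h2, by rwa [h] at h3⟩
    · exact Or.inr ⟨n, h1, h2, by rw [h] at h3; linarith⟩
  refine (measure_mono hsubset).trans ((measure_union_le _ _).trans ?_)
  rw [two_mul]
  exact add_le_add (measure_exists_le_mul_sum_le hind hmeas hint hge hle u N)
    (measure_exists_le_mul_sum_le hind hmeas hint' hge' hle' u N)

end MaximalInequality

/-! ### Moment generating functions near the origin -/

section ExponentialMoments

theorem integrable_exp_mul_of_integrable_exp_mul_abs {ρ : Measure ℝ} {c : ℝ}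
    (hc : Integrable (fun x => Real.exp (c * |x|)) ρ) {l : ℝ} (hl : |l| ≤ c) :
    Integrable (fun x => Real.exp (l * x)) ρ := by
  refine hc.mono' (by fun_prop) (ae_of_all _ fun x => ?_)
  rw [Real.norm_of_nonneg (Real.exp_pos _).le, Real.exp_le_exp]
  refine (le_abs_self _).trans ?_
  rw [abs_mul]
  gcongr

theorem one_le_mgf_of_integral_eq_zero {ρ : Measure ℝ} [IsProbabilityMeasure ρ]
    (h0 : ∫ x, x ∂ρ = 0) (hi : Integrable (fun x : ℝ => x) ρ) {l : ℝ}
    (hl : Integrable (fun x => Real.exp (l * x)) ρ) : 1 ≤ mgf id ρ l := by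
  have h : ∫ x, (l * x + 1) ∂ρ ≤ ∫ x, Real.exp (l * x) ∂ρ :=
    integral_mono ((hi.const_mul l).add (integrable_const 1)) hl fun x => Real.add_one_le_exp _
  rw [integral_add (hi.const_mul l) (integrable_const 1), integral_const_mul, h0] at h
  simpa [mgf] using h

theorem Real.exp_le_one_add_add_sq_mul_exp_abs (y : ℝ) :
    Real.exp y ≤ 1 + y + y ^ 2 * Real.exp |y| := by
  have h := Complex.norm_exp_sub_sum_le_norm_mul_exp (y : ℂ) 2
  simp only [Finset.sum_range_succ, Finset.sum_range_zero, pow_zero, pow_one, Nat.factorial,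
    Complex.norm_real, Real.norm_eq_abs, sq_abs] at h
  have h2 : Complex.exp (y : ℂ) - (0 + 1 / ((1 : ℕ) : ℂ) + (y : ℂ) / (((0 + 1) * 1 : ℕ) : ℂ)) =
      ((Real.exp y - (1 + y) : ℝ) : ℂ) := by
    push_cast
    ring
  rw [h2, Complex.norm_real, Real.norm_eq_abs] at h
  linarith [le_abs_self (Real.exp y - (1 + y))]

/-- A centred law with an exponential moment has a sub-Gaussian moment generating function
near the origin. -/
theorem mgf_le_exp_mul_sq {ρ : Measure ℝ} [IsProbabilityMeasure ρ] {c : ℝ} (hc0 : 0 < c)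
    (hc : Integrable (fun x => Real.exp (c * |x|)) ρ) (h0 : ∫ x, x ∂ρ = 0)
    (hi : Integrable (fun x : ℝ => x) ρ) {l : ℝ} (hl : |l| ≤ c / 2) :
    mgf id ρ l ≤ Real.exp ((8 / c ^ 2 * ∫ x, Real.exp (c * |x|) ∂ρ) * l ^ 2) := by
  have hle : |l| ≤ c := by linarith
  -- Half of the exponent `c |x|` pays for `exp |l x|`, the other half for `x ^ 2`; the factor `8 /
  -- c ^ 2` comes from `(c |x| / 2) ^ 2 / 2 ≤ exp (c |x| / 2)`.
  have hpt : ∀ x : ℝ, Real.exp (l * x) ≤ (l * x + 1) + l ^ 2 * (8 / c ^ 2) * Real.exp (c * |x|) := by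
    intro x
    have h1 := Real.exp_le_one_add_add_sq_mul_exp_abs (l * x)
    have h2 : Real.exp |l * x| ≤ Real.exp (c / 2 * |x|) := by
      rw [Real.exp_le_exp, abs_mul]
      gcongr
    have h3 : x ^ 2 ≤ 8 / c ^ 2 * Real.exp (c / 2 * |x|) := by
      have h4 := Real.quadratic_le_exp_of_nonneg (x := c / 2 * |x|) (by positivity)
      have h5 : (c / 2 * |x|) ^ 2 / 2 = c ^ 2 / 8 * x ^ 2 := by
        rw [mul_pow, sq_abs]
        ring
      have h6 : 0 ≤ c / 2 * |x| := by positivity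
      rw [h5] at h4
      have h7 : c ^ 2 / 8 * x ^ 2 ≤ Real.exp (c / 2 * |x|) := by linarith
      calc x ^ 2 = 8 / c ^ 2 * (c ^ 2 / 8 * x ^ 2) := by field_simp
        _ ≤ _ := by gcongr
    have h8 : Real.exp (c / 2 * |x|) * Real.exp (c / 2 * |x|) = Real.exp (c * |x|) := by
      rw [← Real.exp_add]
      ring_nf
    have h9 : (l * x) ^ 2 * Real.exp |l * x| ≤
        l ^ 2 * (8 / c ^ 2 * Real.exp (c / 2 * |x|)) * Real.exp (c / 2 * |x|) := by
      rw [mul_pow]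
      gcongr
    calc _ ≤ _ := h1
      _ ≤ 1 + l * x + l ^ 2 * (8 / c ^ 2 * Real.exp (c / 2 * |x|)) * Real.exp (c / 2 * |x|) := by
        gcongr
      _ = _ := by
        rw [← h8]
        ring
  have hA : Integrable (fun x => l * x + 1) ρ := (hi.const_mul l).add (integrable_const 1)
  have hint := integral_mono (integrable_exp_mul_of_integrable_exp_mul_abs hc hle)
    (hA.add (hc.const_mul (l ^ 2 * (8 / c ^ 2)))) hpt
  simp only [Pi.add_apply] at hint
  rw [integral_add hA (hc.const_mul _), integral_add (hi.const_mul l) (integrable_const 1),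
    integral_const_mul, integral_const_mul, h0] at hint
  simp only [mul_zero, integral_const, probReal_univ, smul_eq_mul, mul_one, zero_add] at hint
  refine le_trans hint ?_
  refine le_trans (le_of_eq ?_) (Real.add_one_le_exp _)
  ring

end ExponentialMoments

/-! ### Normalized partial sums on dyadic blocks -/

section IteratedLogarithm

theorem one_le_logTwo (x : ℝ) : 1 ≤ logTwo x := by
  unfold logTwo
  split_ifs with h
  · exact le_rfl
  · rw [not_lt] at h
    have h1 : Real.exp 1 ≤ Real.log x := by
      rwa [Real.le_log_iff_exp_le ((Real.exp_pos _).trans_le h)]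
    rwa [Real.le_log_iff_exp_le ((Real.exp_pos _).trans_le h1)]

theorem log_log_le_logTwo {x : ℝ} (hx : 1 ≤ x) : Real.log (Real.log x) ≤ logTwo x := by
  unfold logTwo
  split_ifs with h
  · rcases (Real.log_nonneg hx).eq_or_lt with h0 | h0
    -- At `x = 1` the outer logarithm takes its default value `0`.
    · rw [← h0, Real.log_zero]
      exact zero_le_one
    · rw [Real.log_le_iff_le_exp h0, Real.log_le_iff_le_exp (by linarith)]
      exact h.le
  · exact le_rfl

theorem logTwo_mono : Monotone logTwo := by
  intro x y hxy
  by_cases hx : x < Real.exp (Real.exp 1)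
  · rw [logTwo, if_pos hx]
    exact one_le_logTwo y
  · have hy : ¬ y < Real.exp (Real.exp 1) := fun h => hx (hxy.trans_lt h)
    rw [logTwo, logTwo, if_neg hx, if_neg hy]
    rw [not_lt] at hx
    have hx0 := (Real.exp_pos _).trans_le hx
    have h1 : Real.exp 1 ≤ Real.log x := by rwa [Real.le_log_iff_exp_le hx0]
    exact Real.log_le_log ((Real.exp_pos _).trans_le h1) (Real.log_le_log hx0 hxy)

theorem logTwo_le_self {x : ℝ} (hx : 1 ≤ x) : logTwo x ≤ x := by
  unfold logTwo
  split_ifs with h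
  · exact hx
  · have h0 := Real.log_nonneg hx
    linarith [Real.log_le_self h0, Real.log_le_self (zero_le_one.trans hx)]

theorem one_le_rate {n : ℕ} (hn : 1 ≤ n) : 1 ≤ rate n := by
  have h1 : (1 : ℝ) ≤ n := by exact_mod_cast hn
  rw [rate, Real.one_le_sqrt, one_le_div (zero_lt_one.trans_le (one_le_logTwo _))]
  exact logTwo_le_self h1

theorem rate_nonneg (n : ℕ) : 0 ≤ rate n := Real.sqrt_nonneg _

/-- Since `b_n / n = 1 / √(n Log₂ n)` decreases in `n`, its value at the left end of a dyadic block
dominates the block. -/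
theorem rate_mul_inv_le {n j : ℕ} (h : 2 ^ j ≤ n) :
    rate n * (1 / n) ≤ 1 / Real.sqrt (2 ^ j * logTwo (2 ^ j)) := by
  have hj : (0 : ℝ) < 2 ^ j := by positivity
  have hn : (2 : ℝ) ^ j ≤ n := by exact_mod_cast h
  have hn0 : (0 : ℝ) < n := hj.trans_le hn
  have hL := zero_lt_one.trans_le (one_le_logTwo (2 ^ j))
  have hLn := zero_lt_one.trans_le (one_le_logTwo n)
  have h1 : rate n * (1 / n) = 1 / Real.sqrt (n * logTwo n) := by
    rw [rate, Real.sqrt_div hn0.le, Real.sqrt_mul hn0.le]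
    have := Real.sqrt_pos.2 hn0
    have := Real.sqrt_pos.2 hLn
    field_simp
    rw [Real.sq_sqrt hn0.le]
  rw [h1]
  have := logTwo_mono hn
  gcongr

/-- `Log₂ (2 ^ j)` is at least `log (j log 2)`, so the terms with `j ≥ 1` are at most `(j log 2)⁻²`.
This makes the block probabilities summable. -/
theorem summable_exp_neg_two_mul_logTwo :
    Summable fun j : ℕ => Real.exp (-2 * logTwo (2 ^ j)) := by
  rw [← summable_nat_add_iff 1]
  have hs : Summable fun j : ℕ => (Real.log 2)⁻¹ ^ 2 * (1 / ((j + 1 : ℕ) : ℝ) ^ 2) :=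
    ((summable_nat_add_iff 1).2 (Real.summable_one_div_nat_pow.2 one_lt_two)).mul_left _
  refine hs.of_nonneg_of_le (fun j => (Real.exp_pos _).le) fun j => ?_
  have h2 : (1 : ℝ) ≤ 2 ^ (j + 1) := one_le_pow₀ one_le_two
  have hl := Real.log_pos one_lt_two
  have hj : (0 : ℝ) < (j + 1 : ℕ) := by positivity
  have h3 := log_log_le_logTwo h2
  rw [Real.log_pow] at h3
  have h4 : Real.exp (-2 * logTwo (2 ^ (j + 1))) ≤
      Real.exp (-2 * Real.log ((j + 1 : ℕ) * Real.log 2)) := by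
    rw [Real.exp_le_exp]
    linarith
  refine h4.trans (le_of_eq ?_)
  rw [show -2 * Real.log ((j + 1 : ℕ) * Real.log 2) =
    -(Real.log ((j + 1 : ℕ) * Real.log 2) + Real.log ((j + 1 : ℕ) * Real.log 2)) by ring,
    Real.exp_neg, Real.exp_add, Real.exp_log (by positivity)]
  field_simp

/-- For finite nonzero `R` the single term with `m < R ≤ m + 1` suffices; for `R = ⊤` every term is
at least `1` and the series diverges. -/
theorem ENNReal.pow_le_tsum_indicator_lt (R : ℝ≥0∞) (p : ℕ) (hp : p ≠ 0) :
    R ^ p ≤ ∑' m : ℕ, ((m : ℝ≥0∞) + 1) ^ p * Set.indicator {r : ℝ≥0∞ | (m : ℝ≥0∞) < r} 1 R := by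
  rcases eq_or_ne R ⊤ with rfl | hR
  · have h : ∀ m : ℕ, (1 : ℝ≥0∞) ≤
        ((m : ℝ≥0∞) + 1) ^ p * Set.indicator {r : ℝ≥0∞ | (m : ℝ≥0∞) < r} 1 ⊤ := by
      intro m
      rw [Set.indicator_of_mem (by simp), Pi.one_apply, mul_one]
      exact one_le_pow₀ (by simp)
    refine le_trans ?_ (ENNReal.tsum_le_tsum h)
    rw [ENNReal.tsum_const_eq_top_of_ne_zero one_ne_zero]
    exact le_top
  rcases eq_or_ne R 0 with rfl | h0
  · simp [hp]
  lift R to NNReal using hR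
  have h0' : 0 < R := by
    rw [pos_iff_ne_zero]
    exact_mod_cast h0
  obtain ⟨m, hm⟩ : ∃ m, ⌈R⌉₊ = m + 1 := ⟨⌈R⌉₊ - 1, by have := Nat.ceil_pos.2 h0'; omega⟩
  have h1 : (m : NNReal) < R := by
    rw [← Nat.lt_ceil]
    omega
  have h2 : R ≤ m + 1 := by
    have := Nat.le_ceil R
    rw [hm] at this
    exact_mod_cast this
  refine le_trans ?_ (ENNReal.le_tsum m)
  rw [Set.indicator_of_mem (by rw [Set.mem_ofPred_eq]; exact_mod_cast h1), Pi.one_apply, mul_one]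
  gcongr
  exact_mod_cast h2

variable {Ω : Type*} {mΩ : MeasurableSpace Ω} {μ : Measure Ω}

theorem lintegral_pow_le_tsum_measure_lt {R : Ω → ℝ≥0∞} (hR : Measurable R) (p : ℕ) (hp : p ≠ 0) :
    ∫⁻ ω, R ω ^ p ∂μ ≤ ∑' m : ℕ, ((m : ℝ≥0∞) + 1) ^ p * μ {ω | (m : ℝ≥0∞) < R ω} := by
  refine (lintegral_mono fun ω => ENNReal.pow_le_tsum_indicator_lt (R ω) p hp).trans ?_
  have hset : ∀ m : ℕ, MeasurableSet {r : ℝ≥0∞ | (m : ℝ≥0∞) < r} := fun m => measurableSet_Ioi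
  have hmeas : ∀ m : ℕ, Measurable fun ω =>
      Set.indicator {r : ℝ≥0∞ | (m : ℝ≥0∞) < r} (1 : ℝ≥0∞ → ℝ≥0∞) (R ω) := fun m =>
    (measurable_one.indicator (hset m)).comp hR
  rw [lintegral_tsum fun m => ((hmeas m).const_mul _).aemeasurable]
  refine ENNReal.tsum_le_tsum fun m => ?_
  rw [lintegral_const_mul _ (hmeas m)]
  gcongr
  exact (lintegral_indicator_one (hR (hset m))).le

/-- The normalized partial sum `b_n |(X 0 + ⋯ + X (n - 1)) / n|`. -/
noncomputable def normSum (X : ℕ → Ω → ℝ) (n : ℕ) (ω : Ω) : ℝ :=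
  rate n * |(1 / (n : ℝ)) * ∑ i ∈ Finset.range n, X i ω|

theorem le_mul_abs_sum_of_lt_normSum {X : ℕ → Ω → ℝ} {ω : Ω} {n j : ℕ} {a t : ℝ} (ha : 0 ≤ a)
    (hn : 2 ^ j ≤ n) (h : t < normSum X n ω) :
    a * logTwo (2 ^ j) * t ≤
      a * Real.sqrt (logTwo (2 ^ j) / 2 ^ j) * |∑ i ∈ Finset.range n, X i ω| := by
  have hL := zero_lt_one.trans_le (one_le_logTwo (2 ^ j))
  have hj : (0 : ℝ) < 2 ^ j := by positivity
  have h1 : t ≤ 1 / Real.sqrt (2 ^ j * logTwo (2 ^ j)) * |∑ i ∈ Finset.range n, X i ω| := by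
    refine h.le.trans ?_
    rw [normSum, abs_mul, abs_of_nonneg (by positivity : (0 : ℝ) ≤ 1 / n), ← mul_assoc]
    gcongr
    exact rate_mul_inv_le hn
  calc a * logTwo (2 ^ j) * t ≤ a * logTwo (2 ^ j) *
        (1 / Real.sqrt (2 ^ j * logTwo (2 ^ j)) * |∑ i ∈ Finset.range n, X i ω|) := by gcongr
    _ = _ := by
      rw [Real.sqrt_mul hj.le, Real.sqrt_div hL.le]
      have := Real.sqrt_pos.2 hj
      have := Real.sqrt_pos.2 hL
      field_simp
      rw [Real.sq_sqrt hL.le]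

/-- Tail bound for the normalized partial sums over a dyadic block. -/
theorem measure_block_lt_normSum_le {X : ℕ → Ω → ℝ} (hind : iIndepFun X μ)
    (hmeas : ∀ i, Measurable (X i)) {a C : ℝ} (ha : 0 < a)
    (hexp : ∀ i, ∀ l : ℝ, |l| ≤ a → Integrable (fun ω => Real.exp (l * X i ω)) μ ∧
      1 ≤ mgf (X i) μ l ∧ mgf (X i) μ l ≤ Real.exp (C * l ^ 2)) {t : ℝ}
    (ht : 2 * C * a ^ 2 + 2 ≤ a * t) (j : ℕ) :
    μ {ω | ∃ n, 2 ^ j ≤ n ∧ n ≤ 2 ^ (j + 1) ∧ t < normSum X n ω} ≤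
      ENNReal.ofReal (2 * Real.exp (2 * C * a ^ 2 + 2 - a * t) * Real.exp (-2 * logTwo (2 ^ j))) := by
  have hj : (0 : ℝ) < 2 ^ j := by positivity
  have hL1 := one_le_logTwo (2 ^ j)
  have hL := zero_lt_one.trans_le hL1
  set L := logTwo (2 ^ j) with hLdef
  -- With this `l` the block's `2 ^ (j + 1)` steps contribute `2 ^ (j + 1) C l² = 2 C a² L`, of the
  -- same order as the threshold `a L t`; `l ≤ a` because `Log₂ x ≤ x`.
  set l := a * Real.sqrt (L / 2 ^ j) with hl
  have hl0 : 0 ≤ l := by positivity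
  have hla : l ≤ a := by
    refine mul_le_of_le_one_right ha.le ?_
    rw [Real.sqrt_le_one, div_le_one hj]
    exact logTwo_le_self (one_le_pow₀ one_le_two)
  have hl2 : l ^ 2 = a ^ 2 * (L / 2 ^ j) := by
    rw [hl, mul_pow, Real.sq_sqrt (by positivity)]
  have hp : |l| ≤ a := by rwa [abs_of_nonneg hl0]
  have hm : |-l| ≤ a := by rwa [abs_neg]
  have hmax := measure_exists_le_mul_abs_sum_le hind hmeas (l := l) (B := C * l ^ 2)
    (fun i => (hexp i l hp).1) (fun i => (hexp i _ hm).1) (fun i => (hexp i l hp).2.1)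
    (fun i => (hexp i _ hm).2.1) (fun i => (hexp i l hp).2.2)
    (fun i => by simpa using (hexp i _ hm).2.2) (a * L * t) (2 ^ (j + 1))
  refine (measure_mono ?_).trans (hmax.trans ?_)
  · rintro ω ⟨n, h1, h2, h3⟩
    exact ⟨n, Nat.one_le_two_pow.trans h1, h2, le_mul_abs_sum_of_lt_normSum ha.le h1 h3⟩
  · rw [show (2 : ℝ≥0∞) = ENNReal.ofReal 2 by simp, ← ENNReal.ofReal_mul zero_le_two, mul_assoc 2,
      ← Real.exp_add]
    gcongr
    rw [hl2]
    push_cast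
    have : (2 : ℝ) ^ (j + 1) * (C * (a ^ 2 * (L / 2 ^ j))) = 2 * C * a ^ 2 * L := by
      field_simp
      ring
    rw [this]
    -- The claim amounts to `(a t - 2 C a² - 2) (L - 1) ≥ 0`.
    nlinarith

theorem exists_block {n : ℕ} (hn : 1 ≤ n) : 2 ^ Nat.log 2 n ≤ n ∧ n ≤ 2 ^ (Nat.log 2 n + 1) :=
  ⟨Nat.pow_log_le_self 2 (by omega), (Nat.lt_pow_succ_log_self one_lt_two n).le⟩

/-- The supremum over `n ≥ 1` of the normalized partial sums. -/
noncomputable def supNormSum (X : ℕ → Ω → ℝ) (ω : Ω) : ℝ≥0∞ :=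
  ⨆ (n : ℕ) (_ : 1 ≤ n), ENNReal.ofReal (normSum X n ω)

theorem measurable_supNormSum {X : ℕ → Ω → ℝ} (hmeas : ∀ i, Measurable (X i)) :
    Measurable (supNormSum X) := by
  refine Measurable.iSup fun n => Measurable.iSup fun _ => Measurable.ennreal_ofReal ?_
  have : Measurable fun ω => (1 / (n : ℝ)) * ∑ i ∈ Finset.range n, X i ω :=
    (Finset.measurable_sum _ fun i _ => hmeas i).const_mul _
  exact (continuous_abs.measurable.comp this).const_mul _

/-- Exponential tails of the supremum of the normalized partial sums. -/
theorem measure_lt_supNormSum_le {X : ℕ → Ω → ℝ} (hind : iIndepFun X μ)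
    (hmeas : ∀ i, Measurable (X i)) {a C : ℝ} (ha : 0 < a)
    (hexp : ∀ i, ∀ l : ℝ, |l| ≤ a → Integrable (fun ω => Real.exp (l * X i ω)) μ ∧
      1 ≤ mgf (X i) μ l ∧ mgf (X i) μ l ≤ Real.exp (C * l ^ 2)) (m : ℕ) :
    μ {ω | (m : ℝ≥0∞) < supNormSum X ω} ≤ ENNReal.ofReal
      ((2 * (∑' j : ℕ, Real.exp (-2 * logTwo (2 ^ j))) + 1) *
        Real.exp (2 * C * a ^ 2 + 2 - a * m)) := by
  have : IsProbabilityMeasure μ := hind.isProbabilityMeasure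
  have hE : 0 ≤ ∑' j : ℕ, Real.exp (-2 * logTwo (2 ^ j)) :=
    tsum_nonneg fun j => (Real.exp_pos _).le
  set E := ∑' j : ℕ, Real.exp (-2 * logTwo (2 ^ j)) with hEdef
  -- Below the threshold the right-hand side is at least `1`, so only large `m` needs the block
  -- estimates.
  rcases lt_or_ge (a * m) (2 * C * a ^ 2 + 2) with ht | ht
  · refine prob_le_one.trans ?_
    rw [ENNReal.one_le_ofReal]
    have : 1 ≤ Real.exp (2 * C * a ^ 2 + 2 - a * m) := Real.one_le_exp (by linarith)
    nlinarith
  · have hsub : {ω | (m : ℝ≥0∞) < supNormSum X ω} ⊆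
        ⋃ j : ℕ, {ω | ∃ n, 2 ^ j ≤ n ∧ n ≤ 2 ^ (j + 1) ∧ (m : ℝ) < normSum X n ω} := by
      intro ω hω
      rw [Set.mem_ofPred_eq, supNormSum, lt_iSup_iff] at hω
      obtain ⟨n, hω⟩ := hω
      rw [lt_iSup_iff] at hω
      obtain ⟨hn, hω⟩ := hω
      rw [ENNReal.natCast_lt_ofReal] at hω
      exact Set.mem_iUnion.2 ⟨Nat.log 2 n, n, (exists_block hn).1, (exists_block hn).2, hω⟩
    refine (measure_mono hsub).trans ((measure_iUnion_le _).trans ?_)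
    refine (ENNReal.tsum_le_tsum fun j =>
      measure_block_lt_normSum_le hind hmeas ha hexp ht j).trans ?_
    rw [← ENNReal.ofReal_tsum_of_nonneg (fun j => by positivity)
      (summable_exp_neg_two_mul_logTwo.mul_left _), tsum_mul_left]
    rw [← hEdef]
    refine ENNReal.ofReal_le_ofReal ?_
    nlinarith [Real.exp_pos (2 * C * a ^ 2 + 2 - a * m)]

/-- Borel–Cantelli over dyadic blocks: almost surely only finitely many blocks contain an exceedance
of `t`. -/
theorem ae_eventually_normSum_le {X : ℕ → Ω → ℝ} (hind : iIndepFun X μ)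
    (hmeas : ∀ i, Measurable (X i)) {a C : ℝ} (ha : 0 < a)
    (hexp : ∀ i, ∀ l : ℝ, |l| ≤ a → Integrable (fun ω => Real.exp (l * X i ω)) μ ∧
      1 ≤ mgf (X i) μ l ∧ mgf (X i) μ l ≤ Real.exp (C * l ^ 2)) {t : ℝ}
    (ht : 2 * C * a ^ 2 + 2 ≤ a * t) :
    ∀ᵐ ω ∂μ, ∀ᶠ n in atTop, normSum X n ω ≤ t := by
  have hsum : ∑' j : ℕ, μ {ω | ∃ n, 2 ^ j ≤ n ∧ n ≤ 2 ^ (j + 1) ∧ t < normSum X n ω} ≠ ⊤ := by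
    refine ne_top_of_le_ne_top ?_ (ENNReal.tsum_le_tsum fun j =>
      measure_block_lt_normSum_le hind hmeas ha hexp ht j)
    rw [← ENNReal.ofReal_tsum_of_nonneg (fun j => by positivity)
      (summable_exp_neg_two_mul_logTwo.mul_left _)]
    exact ENNReal.ofReal_ne_top
  filter_upwards [ae_eventually_notMem hsum] with ω hω
  obtain ⟨J, hJ⟩ := eventually_atTop.1 hω
  filter_upwards [eventually_ge_atTop (2 ^ J)] with n hn
  have hn1 : 1 ≤ n := Nat.one_le_two_pow.trans hn
  by_contra! hlt
  exact hJ (Nat.log 2 n) (Nat.le_log_of_pow_le one_lt_two hn)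
    ⟨n, (exists_block hn1).1, (exists_block hn1).2, hlt⟩

theorem summable_pow_mul_exp_sub (A D : ℝ) {a : ℝ} (ha : 0 < a) (p : ℕ) :
    Summable fun m : ℕ => ((m : ℝ) + 1) ^ p * (A * Real.exp (D - a * m)) := by
  have hr : ‖Real.exp (-a)‖ < 1 := by
    rw [Real.norm_of_nonneg (Real.exp_pos _).le]
    exact Real.exp_lt_one_iff.2 (by linarith)
  have h0 : Summable fun n : ℕ => (n : ℝ) ^ p * Real.exp (-a) ^ n :=
    summable_pow_mul_geometric_of_norm_lt_one p hr
  have h1 : Summable fun n : ℕ => ((n + 1 : ℕ) : ℝ) ^ p * Real.exp (-a) ^ (n + 1) :=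
    (summable_nat_add_iff (f := fun n : ℕ => (n : ℝ) ^ p * Real.exp (-a) ^ n) 1).2 h0
  refine (summable_congr fun m => ?_).1 (h1.mul_left (A * Real.exp (D + a)))
  rw [← Real.exp_nat_mul, show D - a * m = (D + a) + ((m + 1 : ℕ) : ℝ) * -a by push_cast; ring,
    Real.exp_add (D + a)]
  push_cast
  ring

end IteratedLogarithm

/-! ### Bounded law of the iterated logarithm with moments -/

/-- For i.i.d. centred variables with an exponential moment, the supremum of the partial sums in
the normalization of the law of the iterated logarithm has a fourth moment, and their upper limit
is bounded, by a constant that depends on the law only. -/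
theorem exists_bound_supNormSum (ρ : Measure ℝ) [IsProbabilityMeasure ρ] {c : ℝ} (hc0 : 0 < c)
    (hc : Integrable (fun x => Real.exp (c * |x|)) ρ) (h0 : ∫ x, x ∂ρ = 0) :
    ∃ K : NNReal, ∀ (Ω : Type) (_ : MeasurableSpace Ω) (μ : Measure Ω) (X : ℕ → Ω → ℝ),
      iIndepFun X μ → (∀ i, Measurable (X i)) → (∀ i, μ.map (X i) = ρ) →
        ∫⁻ ω, supNormSum X ω ^ 4 ∂μ ≤ K ∧ ∀ᵐ ω ∂μ, ∀ᶠ n in atTop, normSum X n ω ≤ K := by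
  have hi : Integrable (fun x : ℝ => x) ρ := by
    refine (hc.const_mul c⁻¹).mono' (by fun_prop) (ae_of_all _ fun x => ?_)
    have h := Real.add_one_le_exp (c * |x|)
    rw [Real.norm_eq_abs]
    calc |x| = c⁻¹ * (c * |x|) := by field_simp
      _ ≤ _ := by gcongr; linarith
  set C := 8 / c ^ 2 * ∫ x, Real.exp (c * |x|) ∂ρ with hCdef
  have hC : 0 ≤ C := by
    have : 0 ≤ ∫ x, Real.exp (c * |x|) ∂ρ := integral_nonneg fun x => (Real.exp_pos _).le
    positivity
  set a := c / 2 with hadef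
  have ha : 0 < a := by positivity
  set E := ∑' j : ℕ, Real.exp (-2 * logTwo (2 ^ j)) with hEdef
  have hE : 0 ≤ E := tsum_nonneg fun j => (Real.exp_pos _).le
  have hsum : Summable fun m : ℕ => ((m : ℝ) + 1) ^ 4 *
      ((2 * E + 1) * Real.exp (2 * C * a ^ 2 + 2 - a * m)) :=
    summable_pow_mul_exp_sub _ _ ha 4
  set M := ∑' m : ℕ, ((m : ℝ) + 1) ^ 4 *
      ((2 * E + 1) * Real.exp (2 * C * a ^ 2 + 2 - a * m)) with hM
  -- `M` bounds the fourth moment by summing the tails; the other entry is the smallest `t` admitted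
  -- by the Borel–Cantelli bound.
  refine ⟨max M.toNNReal ((2 * C * a ^ 2 + 2) / a).toNNReal, ?_⟩
  intro Ω _ μ X hind hmeas hlaw
  have hexp : ∀ i, ∀ l : ℝ, |l| ≤ a → Integrable (fun ω => Real.exp (l * X i ω)) μ ∧
      1 ≤ mgf (X i) μ l ∧ mgf (X i) μ l ≤ Real.exp (C * l ^ 2) := by
    intro i l hl
    have hint : Integrable (fun x => Real.exp (l * x)) ρ :=
      integrable_exp_mul_of_integrable_exp_mul_abs hc (hl.trans (by rw [hadef]; linarith))
    have hmgf : mgf (X i) μ l = mgf id ρ l := by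
      rw [← hlaw i, mgf_id_map (hmeas i).aemeasurable]
    rw [hmgf]
    refine ⟨?_, one_le_mgf_of_integral_eq_zero h0 hi hint, mgf_le_exp_mul_sq hc0 hc h0 hi hl⟩
    rw [← hlaw i] at hint
    exact hint.comp_measurable (hmeas i)
  constructor
  · have h1 : ∫⁻ ω, supNormSum X ω ^ 4 ∂μ ≤ ENNReal.ofReal M := by
      refine (lintegral_pow_le_tsum_measure_lt (measurable_supNormSum hmeas) 4 (by norm_num)).trans ?_
      rw [hM, ENNReal.ofReal_tsum_of_nonneg (fun m => by positivity) hsum]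
      refine ENNReal.tsum_le_tsum fun m => ?_
      rw [ENNReal.ofReal_mul (by positivity), ENNReal.ofReal_pow (by positivity),
        ENNReal.ofReal_add (by positivity) zero_le_one, ENNReal.ofReal_natCast, ENNReal.ofReal_one]
      gcongr
      exact measure_lt_supNormSum_le hind hmeas ha hexp m
    refine h1.trans ?_
    rw [ENNReal.ofReal]
    exact_mod_cast le_max_left _ _
  · have ht : 2 * C * a ^ 2 + 2 ≤ a * ((2 * C * a ^ 2 + 2) / a) := by
      rw [mul_div_cancel₀ _ ha.ne']
    filter_upwards [ae_eventually_normSum_le hind hmeas ha hexp ht] with ω hω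
    filter_upwards [hω] with n hn
    refine hn.trans ((Real.le_coe_toNNReal _).trans ?_)
    exact_mod_cast le_max_right _ _

/-! ### Couplings of Gaussian laws -/

section Coupling

open scoped MatrixOrder RealInnerProductSpace
open Matrix

theorem wassersteinDist_map_map_le {Ω S : Type*} [MeasurableSpace Ω] [PseudoEMetricSpace S]
    [MeasurableSpace S] [OpensMeasurableSpace (S × S)] (ν : Measure Ω) {f g : Ω → S} (hf : Measurable f)
    (hg : Measurable g) :
    wassersteinDist 2 (ν.map f) (ν.map g) ≤ (∫⁻ x, edist (f x) (g x) ^ (2 : ℝ) ∂ν) ^ (1 / 2 : ℝ) := by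
  refine (iInf₂_le (ν.map fun x => (f x, g x))
    ⟨by rw [Measure.map_map measurable_fst (hf.prodMk hg)]; rfl,
      by rw [Measure.map_map measurable_snd (hf.prodMk hg)]; rfl⟩).trans ?_
  gcongr
  rw [lintegral_map (by fun_prop) (hf.prodMk hg)]

variable {d : ℕ}

/-- A Gaussian law is determined by its mean and covariance. `M` need not be symmetric, which allows
the factor `S * T` of the plug-in covariance. -/
theorem map_const_add_toEuclideanCLM_stdGaussian (m : EuclideanSpace ℝ (Fin d))
    (M : Matrix (Fin d) (Fin d) ℝ) :
    (stdGaussian (EuclideanSpace ℝ (Fin d))).map (fun x => m + toEuclideanCLM (𝕜 := ℝ) M x) =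
      multivariateGaussian m (M * star M) := by
  have hcomp : (fun x => m + toEuclideanCLM (𝕜 := ℝ) M x) =
      (fun x => m + x) ∘ toEuclideanCLM (𝕜 := ℝ) M := rfl
  have hmap : (stdGaussian (EuclideanSpace ℝ (Fin d))).map
      (fun x => m + toEuclideanCLM (𝕜 := ℝ) M x) =
      ((stdGaussian (EuclideanSpace ℝ (Fin d))).map (toEuclideanCLM (𝕜 := ℝ) M)).map
        (fun x => m + x) := by
    rw [hcomp, Measure.map_map (measurable_const_add m) (by fun_prop)]
  have : IsGaussian ((stdGaussian (EuclideanSpace ℝ (Fin d))).map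
      (fun x => m + toEuclideanCLM (𝕜 := ℝ) M x)) := by
    rw [hmap]
    infer_instance
  refine IsGaussian.ext ?_ ?_
  · simp only [id_eq, integral_id_multivariateGaussian]
    rw [integral_map (by fun_prop) (by fun_prop), integral_add (integrable_const _), integral_const]
    · simp [ContinuousLinearMap.integral_comp_comm _ IsGaussian.integrable_fun_id]
    · exact IsGaussian.integrable_id.comp_measurable (by fun_prop)
  · ext x y
    have hpsd := Matrix.posSemidef_self_mul_conjTranspose M
    rw [← Matrix.star_eq_conjTranspose] at hpsd
    rw [covarianceBilin_multivariateGaussian hpsd, hmap,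
      covarianceBilin_map_const_add, covarianceBilin_map IsGaussian.memLp_two_id,
      covarianceBilin_stdGaussian, innerSL_apply_apply, ContinuousLinearMap.adjoint_inner_left,
      ← ContinuousLinearMap.star_eq_adjoint, ← map_star, ← ContinuousLinearMap.comp_apply,
      ← ContinuousLinearMap.mul_def, ← map_mul, inner_toEuclideanCLM]

theorem norm_toEuclideanCLM_sq_le (A : Matrix (Fin d) (Fin d) ℝ) (x : EuclideanSpace ℝ (Fin d)) :
    ‖toEuclideanCLM (𝕜 := ℝ) A x‖ ^ 2 ≤ (∑ k, ∑ l, A k l ^ 2) * ‖x‖ ^ 2 := by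
  rw [EuclideanSpace.real_norm_sq_eq, EuclideanSpace.real_norm_sq_eq, Finset.sum_mul]
  refine Finset.sum_le_sum fun k _ => ?_
  rw [ofLp_toEuclideanCLM]
  exact Finset.sum_mul_sq_le_sq_mul_sq Finset.univ (A k) x.ofLp

theorem norm_toEuclideanCLM_le (A : Matrix (Fin d) (Fin d) ℝ) (x : EuclideanSpace ℝ (Fin d)) :
    ‖toEuclideanCLM (𝕜 := ℝ) A x‖ ≤ (∑ k, ∑ l, |A k l|) * ‖x‖ := by
  refine le_of_sq_le_sq ((norm_toEuclideanCLM_sq_le A x).trans ?_) (by positivity)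
  rw [mul_pow]
  gcongr
  simp_rw [← sq_abs (A _ _), ← Finset.sum_product']
  exact Finset.sum_sq_le_sq_sum_of_nonneg fun i _ => abs_nonneg _

/-- With `T = CFC.sqrt A` and `y = (1 - T) x` one has `(1 - A) x = y + T y`, and `⟪y, T y⟫ ≥ 0`
gives `‖y + T y‖ ≥ ‖y‖`. No lower bound on the spectrum of `A` enters, so singular sample
covariances are covered. -/
theorem norm_sub_sqrt_le {A : Matrix (Fin d) (Fin d) ℝ} (hA : A.PosSemidef)
    (x : EuclideanSpace ℝ (Fin d)) :
    ‖toEuclideanCLM (𝕜 := ℝ) (1 - CFC.sqrt A) x‖ ≤ ‖toEuclideanCLM (𝕜 := ℝ) (1 - A) x‖ := by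
  set T := CFC.sqrt A with hT
  have hTT : T * T = A := CFC.sqrt_mul_sqrt_self A hA.nonneg
  have hTpos : T.PosSemidef := Matrix.nonneg_iff_posSemidef.1 (CFC.sqrt_nonneg A)
  set y := toEuclideanCLM (𝕜 := ℝ) (1 - T) x with hy
  have h1 : toEuclideanCLM (𝕜 := ℝ) (1 - A) x = y + toEuclideanCLM (𝕜 := ℝ) T y := by
    have : 1 - A = (1 + T) * (1 - T) := by
      rw [← hTT]
      noncomm_ring
    rw [this, map_mul, mul_apply_eq_comp, ← hy, map_add, map_one]
    rfl
  have h2 : 0 ≤ ⟪y, toEuclideanCLM (𝕜 := ℝ) T y⟫ := by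
    rw [inner_toEuclideanCLM]
    simpa using hTpos.dotProduct_mulVec_nonneg y.ofLp
  rw [h1]
  refine le_of_sq_le_sq ?_ (norm_nonneg _)
  rw [norm_add_sq_real]
  nlinarith [sq_nonneg ‖toEuclideanCLM (𝕜 := ℝ) T y‖]

/-- The `L²` size of `1 + ‖Z‖` for a standard Gaussian vector `Z`. -/
noncomputable def gaussianSize (d : ℕ) : ℝ≥0∞ :=
  (∫⁻ x, ENNReal.ofReal (1 + ‖x‖) ^ (2 : ℝ) ∂stdGaussian (EuclideanSpace ℝ (Fin d))) ^ (1 / 2 : ℝ)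

theorem gaussianSize_ne_top (d : ℕ) : gaussianSize d ≠ ⊤ := by
  have h : MemLp (fun x : EuclideanSpace ℝ (Fin d) => 1 + ‖x‖) 2
      (stdGaussian (EuclideanSpace ℝ (Fin d))) := by
    have hid : MemLp (fun x : EuclideanSpace ℝ (Fin d) => x) 2
        (stdGaussian (EuclideanSpace ℝ (Fin d))) := IsGaussian.memLp_two_id
    have h1 : MemLp (fun _ : EuclideanSpace ℝ (Fin d) => (1 : ℝ)) 2
        (stdGaussian (EuclideanSpace ℝ (Fin d))) := memLp_const 1
    exact h1.add hid.norm
  have h2 := lintegral_rpow_enorm_lt_top_of_eLpNorm_lt_top two_ne_zero ENNReal.ofNat_ne_top h.2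
  refine ENNReal.rpow_ne_top_of_nonneg (by norm_num) ?_
  refine ne_of_eq_of_ne (lintegral_congr fun x => ?_) h2.ne
  rw [Real.enorm_of_nonneg (by positivity), ENNReal.toReal_ofNat]

/-- Both laws are driven by one standard Gaussian vector `x`, and the two images differ by at most
`s (1 + ‖x‖)`. -/
theorem wassersteinDist_multivariateGaussian_le {m m' : EuclideanSpace ℝ (Fin d)}
    {S T : Matrix (Fin d) (Fin d) ℝ} {s : ℝ} (hs : 0 ≤ s)
    (hm : ‖m - m'‖ ≤ s) (hT : ∀ x, ‖toEuclideanCLM (𝕜 := ℝ) (S - T) x‖ ≤ s * ‖x‖) :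
    wassersteinDist 2 (multivariateGaussian m (S * star S)) (multivariateGaussian m' (T * star T)) ≤
      ENNReal.ofReal s * gaussianSize d := by
  rw [← map_const_add_toEuclideanCLM_stdGaussian, ← map_const_add_toEuclideanCLM_stdGaussian]
  refine (wassersteinDist_map_map_le _ (by fun_prop) (by fun_prop)).trans ?_
  have hpt : ∀ x : EuclideanSpace ℝ (Fin d),
      edist (m + toEuclideanCLM (𝕜 := ℝ) S x) (m' + toEuclideanCLM (𝕜 := ℝ) T x) ^ (2 : ℝ) ≤
        ENNReal.ofReal s ^ (2 : ℝ) * ENNReal.ofReal (1 + ‖x‖) ^ (2 : ℝ) := by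
    intro x
    rw [← ENNReal.mul_rpow_of_nonneg _ _ zero_le_two, ← ENNReal.ofReal_mul hs, edist_dist,
      dist_eq_norm]
    gcongr
    have h1 : m + toEuclideanCLM (𝕜 := ℝ) S x - (m' + toEuclideanCLM (𝕜 := ℝ) T x) =
        (m - m') + toEuclideanCLM (𝕜 := ℝ) (S - T) x := by
      rw [map_sub, _root_.sub_apply]
      abel
    rw [h1]
    linarith [norm_add_le (m - m') (toEuclideanCLM (𝕜 := ℝ) (S - T) x), hT x]
  refine (ENNReal.rpow_le_rpow (lintegral_mono hpt) (by norm_num)).trans (le_of_eq ?_)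
  rw [lintegral_const_mul _ (by fun_prop), ENNReal.mul_rpow_of_nonneg _ _ (by norm_num),
    ← ENNReal.rpow_mul, gaussianSize]
  norm_num

end Coupling

/-! ### Sample moments under affine maps -/

section SampleMoments

open scoped MatrixOrder
open Matrix

variable {d : ℕ}

theorem sampleCov_eq_sum (n : ℕ) (ω : ℕ → EuclideanSpace ℝ (Fin d)) :
    sampleCov n ω = (1 / (n : ℝ)) • ∑ i ∈ Finset.range n,
      vecMulVec (ω i - sampleMean n ω).ofLp (ω i - sampleMean n ω).ofLp := by
  ext k l
  simp [sampleCov, Matrix.sum_apply, vecMulVec_apply]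

theorem sampleCov_posSemidef (n : ℕ) (ω : ℕ → EuclideanSpace ℝ (Fin d)) :
    (sampleCov n ω).PosSemidef := by
  rw [sampleCov_eq_sum]
  refine Matrix.PosSemidef.smul (Matrix.posSemidef_sum _ fun i _ => ?_) (by positivity)
  simpa using Matrix.posSemidef_vecMulVec_self_star (ω i - sampleMean n ω).ofLp

theorem sampleMean_affine {n : ℕ} (hn : 1 ≤ n) (m : EuclideanSpace ℝ (Fin d))
    (S : Matrix (Fin d) (Fin d) ℝ) (η : ℕ → EuclideanSpace ℝ (Fin d)) :
    sampleMean n (fun i => m + toEuclideanCLM (𝕜 := ℝ) S (η i)) =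
      m + toEuclideanCLM (𝕜 := ℝ) S (sampleMean n η) := by
  have hn0 : (n : ℝ) ≠ 0 := by positivity
  rw [sampleMean, sampleMean, Finset.sum_add_distrib, map_smul, map_sum, smul_add]
  simp only [Finset.sum_const, Finset.card_range, ← Nat.cast_smul_eq_nsmul ℝ, smul_smul]
  rw [one_div_mul_cancel hn0, one_smul]

theorem sampleCov_affine {n : ℕ} (hn : 1 ≤ n) (m : EuclideanSpace ℝ (Fin d))
    (S : Matrix (Fin d) (Fin d) ℝ) (η : ℕ → EuclideanSpace ℝ (Fin d)) :
    sampleCov n (fun i => m + toEuclideanCLM (𝕜 := ℝ) S (η i)) =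
      S * sampleCov n η * star S := by
  rw [sampleCov_eq_sum, sampleCov_eq_sum, sampleMean_affine hn, Matrix.mul_smul, Matrix.smul_mul,
    Finset.mul_sum, Finset.sum_mul]
  congr 1
  refine Finset.sum_congr rfl fun i _ => ?_
  rw [Matrix.mul_vecMulVec, Matrix.vecMulVec_mul, add_sub_add_left_eq_sub, ← map_sub,
    ofLp_toEuclideanCLM, Matrix.star_eq_conjTranspose, Matrix.conjTranspose_eq_transpose_of_trivial,
    Matrix.vecMul_transpose]

theorem sampleCov_apply {n : ℕ} (hn : 1 ≤ n) (η : ℕ → EuclideanSpace ℝ (Fin d)) (k l : Fin d) :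
    sampleCov n η k l = (1 / (n : ℝ)) * ∑ i ∈ Finset.range n, η i k * η i l -
      sampleMean n η k * sampleMean n η l := by
  have hn0 : (n : ℝ) ≠ 0 := by positivity
  have hmean : ∀ k, ∑ i ∈ Finset.range n, η i k = n * sampleMean n η k := by
    intro k
    simp [sampleMean, mul_inv_cancel_left₀ hn0]
  simp only [sampleCov, Matrix.of_apply, sub_mul, mul_sub, Finset.sum_sub_distrib]
  rw [← Finset.sum_mul, ← Finset.mul_sum, hmean, hmean]
  simp only [Finset.sum_const, Finset.card_range, nsmul_eq_mul]
  field_simp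
  ring

/-- The Wasserstein distance between a Gaussian law and the plug-in law, in terms of the
standardized sample. -/
theorem wassersteinDist_plugInGaussian_le {n : ℕ} (hn : 1 ≤ n) (m : EuclideanSpace ℝ (Fin d))
    {V : Matrix (Fin d) (Fin d) ℝ} (hV : V.PosSemidef) (η : ℕ → EuclideanSpace ℝ (Fin d)) :
    wassersteinDist 2 (multivariateGaussian m V)
        (plugInGaussian n fun i => m + toEuclideanCLM (𝕜 := ℝ) (CFC.sqrt V) (η i)) ≤
      ENNReal.ofReal (Real.sqrt V.trace *
        (∑ k, |sampleMean n η k| + ∑ k, ∑ l, |(1 - sampleCov n η) k l|)) * gaussianSize d := by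
  set S := CFC.sqrt V with hS
  have hstar : ∀ A : Matrix (Fin d) (Fin d) ℝ, star (CFC.sqrt A) = CFC.sqrt A :=
    fun A => (CFC.sqrt_nonneg A).isSelfAdjoint
  have hSS : S * S = V := CFC.sqrt_mul_sqrt_self V hV.nonneg
  have hStar : star S = S := hstar V
  set T := CFC.sqrt (sampleCov n η) with hT
  have hTT : T * T = sampleCov n η := CFC.sqrt_mul_sqrt_self _ (sampleCov_posSemidef n η).nonneg
  have hTstar : star T = T := hstar _
  have htr : ∑ k, ∑ l, S k l ^ 2 = V.trace := by
    have h := congrArg Matrix.trace hSS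
    nth_rewrite 2 [← hStar] at h
    rw [← h]
    simp [Matrix.trace, Matrix.mul_apply, Matrix.star_eq_conjTranspose, sq]
  have hSle : ∀ x, ‖toEuclideanCLM (𝕜 := ℝ) S x‖ ≤ Real.sqrt V.trace * ‖x‖ := by
    intro x
    refine le_of_sq_le_sq ((norm_toEuclideanCLM_sq_le S x).trans (le_of_eq ?_)) (by positivity)
    rw [htr, mul_pow, Real.sq_sqrt hV.trace_nonneg]
  have hmean : ‖sampleMean n η‖ ≤ ∑ k, |sampleMean n η k| := by
    refine le_of_sq_le_sq ?_ (Finset.sum_nonneg fun _ _ => abs_nonneg _)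
    rw [EuclideanSpace.real_norm_sq_eq]
    simp_rw [← sq_abs (sampleMean n η _)]
    exact Finset.sum_sq_le_sq_sum_of_nonneg fun i _ => abs_nonneg _
  have hP : 0 ≤ ∑ k, |sampleMean n η k| := Finset.sum_nonneg fun _ _ => abs_nonneg _
  have hQ : 0 ≤ ∑ k, ∑ l, |(1 - sampleCov n η) k l| := by positivity
  -- `S * T` replaces the symmetric square root of `S * sampleCov n η * S`: it keeps `S` as a common
  -- left factor of the difference `S - S * T = S * (1 - T)`.
  have hplug : plugInGaussian n (fun i => m + toEuclideanCLM (𝕜 := ℝ) S (η i)) =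
      multivariateGaussian (m + toEuclideanCLM (𝕜 := ℝ) S (sampleMean n η))
        (S * T * star (S * T)) := by
    rw [plugInGaussian, sampleMean_affine hn, sampleCov_affine hn, star_mul, hTstar, ← hTT]
    simp only [mul_assoc]
  have hV' : V = S * star S := by rw [hStar, hSS]
  rw [hplug]
  nth_rewrite 1 [hV']
  refine wassersteinDist_multivariateGaussian_le (by positivity) ?_ fun x => ?_
  · rw [sub_add_cancel_left, norm_neg]
    refine (hSle _).trans ?_
    gcongr
    linarith
  · have : S - S * T = S * (1 - T) := by rw [mul_sub, mul_one]
    rw [this, map_mul, mul_apply_eq_comp, mul_assoc]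
    refine (hSle _).trans ?_
    gcongr
    refine (norm_sub_sqrt_le (sampleCov_posSemidef n η) x).trans
      ((norm_toEuclideanCLM_le _ x).trans ?_)
    gcongr
    linarith

end SampleMoments

/-! ### Centred first and second moments of the standard Gaussian -/

section GaussianMoments

variable {d : ℕ}

/-- The centred coordinates and products of two coordinates on `ℝ ^ d`. -/
def momentFun (i : Fin d ⊕ (Fin d × Fin d)) (x : EuclideanSpace ℝ (Fin d)) : ℝ :=
  Sum.elim (fun k => x k) (fun p => x p.1 * x p.2 - (1 : Matrix (Fin d) (Fin d) ℝ) p.1 p.2) i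

@[fun_prop]
theorem measurable_momentFun (i : Fin d ⊕ (Fin d × Fin d)) : Measurable (momentFun i) := by
  rcases i with k | p
  · exact (by fun_prop : Measurable fun x : EuclideanSpace ℝ (Fin d) => x k)
  · exact (by fun_prop : Measurable fun x : EuclideanSpace ℝ (Fin d) =>
      x p.1 * x p.2 - (1 : Matrix (Fin d) (Fin d) ℝ) p.1 p.2)

/-- Quadratic growth lets the Gaussian integrability of `exp (c ‖x‖²)` give each moment function an
exponential moment. -/
theorem abs_momentFun_le (i : Fin d ⊕ (Fin d × Fin d)) (x : EuclideanSpace ℝ (Fin d)) :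
    |momentFun i x| ≤ 1 + ‖x‖ ^ 2 := by
  have hk : ∀ k, |x k| ≤ ‖x‖ := fun k => by simpa using PiLp.norm_apply_le x k
  rcases i with k | p
  · have h := hk k
    simp only [momentFun, Sum.elim_inl]
    nlinarith [sq_nonneg (‖x‖ - 1), norm_nonneg x]
  · simp only [momentFun, Sum.elim_inr]
    have h1 : |(1 : Matrix (Fin d) (Fin d) ℝ) p.1 p.2| ≤ 1 := by
      rw [Matrix.one_apply]
      split_ifs <;> simp
    have h2 : |x p.1 * x p.2| ≤ ‖x‖ ^ 2 := by
      rw [abs_mul, sq]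
      exact mul_le_mul (hk _) (hk _) (abs_nonneg _) (norm_nonneg _)
    linarith [abs_sub (x p.1 * x p.2) ((1 : Matrix (Fin d) (Fin d) ℝ) p.1 p.2)]

theorem integral_eval_stdGaussian (k : Fin d) :
    ∫ x, x k ∂stdGaussian (EuclideanSpace ℝ (Fin d)) = 0 :=
  integral_strongDual_stdGaussian (EuclideanSpace.proj k)

theorem memLp_eval_stdGaussian (k : Fin d) :
    MemLp (fun x => x k) 2 (stdGaussian (EuclideanSpace ℝ (Fin d))) :=
  IsGaussian.memLp_two_id.continuousLinearMap_comp
    (EuclideanSpace.proj k : EuclideanSpace ℝ (Fin d) →L[ℝ] ℝ)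

theorem integral_momentFun_stdGaussian (i : Fin d ⊕ (Fin d × Fin d)) :
    ∫ x, momentFun i x ∂stdGaussian (EuclideanSpace ℝ (Fin d)) = 0 := by
  rcases i with k | ⟨k, l⟩
  · exact integral_eval_stdGaussian k
  · have hcov := covariance_eval_multivariateGaussian (μ := (0 : EuclideanSpace ℝ (Fin d)))
      (Matrix.PosSemidef.one (n := Fin d) (R := ℝ)) k l
    rw [multivariateGaussian_zero_one, covariance_eq_sub (memLp_eval_stdGaussian k)
      (memLp_eval_stdGaussian l), integral_eval_stdGaussian] at hcov
    have hint : Integrable (fun x : EuclideanSpace ℝ (Fin d) => x k * x l)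
        (stdGaussian (EuclideanSpace ℝ (Fin d))) :=
      (memLp_eval_stdGaussian k).integrable_mul (memLp_eval_stdGaussian l)
    have hsub := integral_sub hint
      (integrable_const ((1 : Matrix (Fin d) (Fin d) ℝ) k l))
    simp only [Pi.mul_apply, zero_mul, sub_zero] at hcov
    rw [hcov, integral_const, probReal_univ, one_smul, sub_self] at hsub
    exact hsub

theorem exists_bound_supNormSum_momentFun (d : ℕ) :
    ∃ K : NNReal, ∀ (Ω : Type) (_ : MeasurableSpace Ω) (μ : Measure Ω)
      (Z : ℕ → Ω → EuclideanSpace ℝ (Fin d)), iIndepFun Z μ → (∀ i, Measurable (Z i)) →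
        (∀ i, μ.map (Z i) = stdGaussian (EuclideanSpace ℝ (Fin d))) → ∀ j,
          ∫⁻ ω, supNormSum (fun i ω => momentFun j (Z i ω)) ω ^ 4 ∂μ ≤ K ∧
            ∀ᵐ ω ∂μ, ∀ᶠ n in atTop, normSum (fun i ω => momentFun j (Z i ω)) n ω ≤ K := by
  set γ := stdGaussian (EuclideanSpace ℝ (Fin d))
  obtain ⟨c, hc0, hc⟩ := IsGaussian.exists_integrable_exp_sq γ
  have hprob : ∀ j, IsProbabilityMeasure (γ.map (momentFun j)) := fun j =>
    Measure.isProbabilityMeasure_map (measurable_momentFun j).aemeasurable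
  have hexp : ∀ j, Integrable (fun x => Real.exp (c * |x|)) (γ.map (momentFun j)) := by
    intro j
    rw [integrable_map_measure (by fun_prop) (measurable_momentFun j).aemeasurable]
    refine (hc.const_mul (Real.exp c)).mono' ?_ (ae_of_all _ fun x => ?_)
    · exact ((by fun_prop : Measurable fun x : ℝ => Real.exp (c * |x|)).comp
        (measurable_momentFun j)).aestronglyMeasurable
    · rw [Function.comp_apply, Real.norm_of_nonneg (Real.exp_pos _).le, ← Real.exp_add,
        Real.exp_le_exp]
      nlinarith [abs_momentFun_le j x]
  have h0 : ∀ j, ∫ x, x ∂γ.map (momentFun j) = 0 := by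
    intro j
    rw [integral_map (measurable_momentFun j).aemeasurable (by fun_prop)]
    exact integral_momentFun_stdGaussian j
  choose K hK using fun j => exists_bound_supNormSum (γ.map (momentFun j)) hc0 (hexp j) (h0 j)
  refine ⟨∑ j, K j, fun Ω _ μ Z hind hmeas hlaw j => ?_⟩
  have hle : K j ≤ ∑ j, K j := Finset.single_le_sum (fun _ _ => zero_le) (Finset.mem_univ j)
  obtain ⟨h1, h2⟩ := hK j Ω _ μ (fun i ω => momentFun j (Z i ω))
    (hind.comp (fun _ => momentFun j) fun _ => measurable_momentFun j)
    (fun i => (measurable_momentFun j).comp (hmeas i))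
    (fun i => by
      rw [← hlaw i, Measure.map_map (measurable_momentFun j) (hmeas i)]
      rfl)
  refine ⟨h1.trans (by exact_mod_cast hle), ?_⟩
  filter_upwards [h2] with ω hω
  filter_upwards [hω] with n hn
  exact hn.trans (by exact_mod_cast hle)

/-- The sum of the normalized partial sums of all centred moment functions. -/
noncomputable def momentSum (n : ℕ) (η : ℕ → EuclideanSpace ℝ (Fin d)) : ℝ :=
  ∑ j : Fin d ⊕ (Fin d × Fin d), normSum (fun i η => momentFun j (η i)) n η

theorem normSum_nonneg {Ω : Type*} (X : ℕ → Ω → ℝ) (n : ℕ) (ω : Ω) : 0 ≤ normSum X n ω :=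
  mul_nonneg (rate_nonneg n) (abs_nonneg _)

/-- The linear term collects the averages of the moment functions; the square comes from the product
of sample means in the sample covariance, where `b_n ≥ 1` allows `b_n P²` to be replaced by `(b_n
P)²`. -/
theorem rate_mul_sampleDeviation_le {n : ℕ} (hn : 1 ≤ n) (η : ℕ → EuclideanSpace ℝ (Fin d)) :
    rate n * (∑ k, |sampleMean n η k| + ∑ k, ∑ l, |(1 - sampleCov n η) k l|) ≤
      momentSum n η + momentSum n η ^ 2 := by
  have hn0 : (n : ℝ) ≠ 0 := by positivity
  have hr := one_le_rate hn
  have hr0 := rate_nonneg n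
  set P := ∑ k, |sampleMean n η k| with hP
  set Q := ∑ k : Fin d, ∑ l : Fin d,
    |(1 / (n : ℝ)) * ∑ i ∈ Finset.range n, momentFun (Sum.inr (k, l)) (η i)| with hQ
  have hP0 : 0 ≤ P := Finset.sum_nonneg fun _ _ => abs_nonneg _
  have hQ0 : 0 ≤ Q := by positivity
  have hy : momentSum n η = rate n * (P + Q) := by
    rw [momentSum, Fintype.sum_sum_type, Fintype.sum_prod_type, mul_add, hP, hQ, Finset.mul_sum,
      Finset.mul_sum]
    simp only [normSum, Finset.mul_sum, momentFun, Sum.elim_inl, sampleMean]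
    simp [Finset.mul_sum]
  have hcov : ∑ k, ∑ l, |(1 - sampleCov n η) k l| ≤ Q + P * P := by
    rw [hP, Finset.sum_mul_sum, hQ, ← Finset.sum_add_distrib]
    refine Finset.sum_le_sum fun k _ => ?_
    rw [← Finset.sum_add_distrib]
    refine Finset.sum_le_sum fun l _ => ?_
    have h : (1 - sampleCov n η) k l =
        -((1 / (n : ℝ)) * ∑ i ∈ Finset.range n, momentFun (Sum.inr (k, l)) (η i)) +
          sampleMean n η k * sampleMean n η l := by
      simp only [momentFun, Sum.elim_inr, Finset.sum_sub_distrib, Finset.sum_const,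
        Finset.card_range, nsmul_eq_mul]
      rw [Matrix.sub_apply, sampleCov_apply hn]
      field_simp
      ring
    rw [h, ← abs_mul]
    refine (abs_add_le _ _).trans ?_
    rw [abs_neg]
  rw [hy]
  calc rate n * (P + ∑ k, ∑ l, |(1 - sampleCov n η) k l|)
      ≤ rate n * (P + (Q + P * P)) := by gcongr
    _ = rate n * (P + Q) + rate n * 1 * (P * P) := by ring
    _ ≤ rate n * (P + Q) + rate n * rate n * ((P + Q) * (P + Q)) := by
      gcongr <;> linarith
    _ = _ := by ring

end GaussianMoments

/-! ### Uniform bounds for the plug-in estimator -/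

section PlugIn

open scoped MatrixOrder
open Matrix

variable {d : ℕ}

/-- The standardization of a vector with mean `m` and covariance matrix `V`. -/
noncomputable def standardize (m : EuclideanSpace ℝ (Fin d)) (V : Matrix (Fin d) (Fin d) ℝ)
    (x : EuclideanSpace ℝ (Fin d)) : EuclideanSpace ℝ (Fin d) :=
  toEuclideanCLM (𝕜 := ℝ) (CFC.sqrt V)⁻¹ (x - m)

theorem measurable_standardize (m : EuclideanSpace ℝ (Fin d)) (V : Matrix (Fin d) (Fin d) ℝ) :
    Measurable (standardize m V) := by
  unfold standardize
  fun_prop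

theorem isUnit_det_sqrt {V : Matrix (Fin d) (Fin d) ℝ} (hV : V.PosDef) :
    IsUnit (CFC.sqrt V).det := by
  have h : CFC.sqrt V * CFC.sqrt V = V := CFC.sqrt_mul_sqrt_self V hV.posSemidef.nonneg
  have h2 := congrArg Matrix.det h
  rw [Matrix.det_mul] at h2
  refine isUnit_iff_ne_zero.2 fun h0 => hV.det_pos.ne' ?_
  rw [← h2, h0, zero_mul]

theorem add_sqrt_standardize (m : EuclideanSpace ℝ (Fin d)) {V : Matrix (Fin d) (Fin d) ℝ}
    (hV : V.PosDef) (x : EuclideanSpace ℝ (Fin d)) :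
    m + toEuclideanCLM (𝕜 := ℝ) (CFC.sqrt V) (standardize m V x) = x := by
  rw [standardize, ← mul_apply_eq_comp, ← map_mul, Matrix.mul_nonsing_inv _ (isUnit_det_sqrt hV),
    map_one, one_apply_eq_self, add_sub_cancel]

theorem map_standardize (m : EuclideanSpace ℝ (Fin d)) {V : Matrix (Fin d) (Fin d) ℝ}
    (hV : V.PosDef) :
    (multivariateGaussian m V).map (standardize m V) = stdGaussian (EuclideanSpace ℝ (Fin d)) := by
  rw [multivariateGaussian, Measure.map_map (measurable_standardize m V) (by fun_prop)]
  convert Measure.map_id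
  ext1 x
  simp only [Function.comp_apply, standardize, add_sub_cancel_left, id_eq]
  rw [← mul_apply_eq_comp, ← map_mul, Matrix.nonsing_inv_mul _ (isUnit_det_sqrt hV), map_one,
    one_apply_eq_self]

theorem rate_mul_wassersteinDist_le {n : ℕ} (hn : 1 ≤ n) (m : EuclideanSpace ℝ (Fin d))
    {V : Matrix (Fin d) (Fin d) ℝ} (hV : V.PosDef) (ω : ℕ → EuclideanSpace ℝ (Fin d)) :
    ENNReal.ofReal (rate n) * wassersteinDist 2 (multivariateGaussian m V) (plugInGaussian n ω) ≤
      ENNReal.ofReal (Real.sqrt V.trace) * gaussianSize d *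
        ENNReal.ofReal (momentSum n (fun i => standardize m V (ω i)) +
          momentSum n (fun i => standardize m V (ω i)) ^ 2) := by
  have h := wassersteinDist_plugInGaussian_le hn m hV.posSemidef fun i => standardize m V (ω i)
  simp only [add_sqrt_standardize m hV] at h
  refine (mul_le_mul_right h _).trans ?_
  rw [← mul_assoc, ← ENNReal.ofReal_mul (rate_nonneg n), mul_right_comm,
    ← ENNReal.ofReal_mul (Real.sqrt_nonneg _), mul_left_comm]
  gcongr
  exact rate_mul_sampleDeviation_le hn _

/-- This reduces the second moment of the Wasserstein supremum to a fourth moment of normalized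
sums. -/
theorem ENNReal.add_sq_sq_le (y : ℝ≥0∞) : (y + y ^ 2) ^ 2 ≤ 4 * (1 + y ^ 4) := by
  rcases le_total y 1 with h | h
  · calc (y + y ^ 2) ^ 2 ≤ (1 + 1 ^ 2) ^ 2 := by gcongr
      _ = 4 * 1 := by norm_num
      _ ≤ 4 * (1 + y ^ 4) := by gcongr; exact le_self_add
  · have h2 : y ≤ y ^ 2 := le_self_pow₀ h two_ne_zero
    calc (y + y ^ 2) ^ 2 ≤ (y ^ 2 + y ^ 2) ^ 2 := by gcongr
      _ = 4 * y ^ 4 := by ring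
      _ ≤ 4 * (1 + y ^ 4) := by gcongr; exact le_add_self

theorem ENNReal.sum_pow_four_le {ι : Type*} [Fintype ι] (f : ι → ℝ≥0∞) :
    (∑ j, f j) ^ 4 ≤ (Fintype.card ι : ℝ≥0∞) ^ 3 * ∑ j, f j ^ 4 := by
  have h := ENNReal.rpow_sum_le_const_mul_sum_rpow Finset.univ f (p := 4) (by norm_num)
  have h3 : (4 : ℝ) - 1 = (3 : ℕ) := by norm_num
  rw [h3] at h
  simp only [← Nat.cast_ofNat (R := ℝ) (n := 4), ENNReal.rpow_natCast] at h
  exact h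

/-- Dimension-dependent bounds for the plug-in estimator, uniform over all Gaussian laws. -/
theorem exists_bound_plugInGaussian (d : ℕ) :
    ∃ A B : NNReal, ∀ (m : EuclideanSpace ℝ (Fin d)) (V : Matrix (Fin d) (Fin d) ℝ), V.PosDef →
      (∫⁻ ω, (⨆ (n : ℕ) (_ : 1 ≤ n), ENNReal.ofReal (rate n) *
          wassersteinDist 2 (multivariateGaussian m V) (plugInGaussian n ω)) ^ 2
        ∂(Measure.infinitePi fun _ : ℕ => multivariateGaussian m V) ≤
          ENNReal.ofReal V.trace * A) ∧
      ∀ᵐ ω ∂(Measure.infinitePi fun _ : ℕ => multivariateGaussian m V),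
        limsup (fun n : ℕ => ENNReal.ofReal (rate n) *
          wassersteinDist 2 (multivariateGaussian m V) (plugInGaussian n ω)) atTop ≤
            ENNReal.ofReal (Real.sqrt V.trace) * B := by
  obtain ⟨K, hK⟩ := exists_bound_supNormSum_momentFun d
  lift gaussianSize d to NNReal using gaussianSize_ne_top d with G hG
  set N := Fintype.card (Fin d ⊕ (Fin d × Fin d)) with hN
  set q : NNReal := N * K with hq
  -- `N ^ 3 * (N * K)` bounds the fourth moment of a sum of `N` suprema by the power mean
  -- inequality; `q = N K` eventually bounds `momentSum`.
  refine ⟨G ^ 2 * (4 * (1 + N ^ 3 * (N * K))), G * (q + q ^ 2), fun m V hV => ?_⟩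
  set μ := Measure.infinitePi fun _ : ℕ => multivariateGaussian m V with hμ
  have hmeas : ∀ i, Measurable fun ω : ℕ → EuclideanSpace ℝ (Fin d) => standardize m V (ω i) :=
    fun i => (measurable_standardize m V).comp (measurable_pi_apply i)
  have hind : iIndepFun (fun i (ω : ℕ → EuclideanSpace ℝ (Fin d)) => standardize m V (ω i)) μ :=
    iIndepFun_infinitePi fun _ => measurable_standardize m V
  have hlaw : ∀ i, μ.map (fun ω => standardize m V (ω i)) =
      stdGaussian (EuclideanSpace ℝ (Fin d)) := by
    intro i
    rw [← map_standardize m hV, ← Measure.infinitePi_map_eval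
      (fun _ : ℕ => multivariateGaussian m V) i, Measure.map_map (measurable_standardize m V)
        (measurable_pi_apply i)]
    rfl
  have hbd := hK _ _ μ _ hind hmeas hlaw
  set X : (Fin d ⊕ (Fin d × Fin d)) → ℕ → (ℕ → EuclideanSpace ℝ (Fin d)) → ℝ :=
    fun j i ω => momentFun j (standardize m V (ω i)) with hX
  have hXmeas : ∀ j i, Measurable (X j i) := fun j i => (measurable_momentFun j).comp (hmeas i)
  have hmom : ∀ n ω, momentSum n (fun i => standardize m V (ω i)) = ∑ j, normSum (X j) n ω :=
    fun n ω => rfl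
  have hsq : ENNReal.ofReal (Real.sqrt V.trace) ^ 2 = ENNReal.ofReal V.trace := by
    rw [← ENNReal.ofReal_pow (Real.sqrt_nonneg _), Real.sq_sqrt hV.posSemidef.trace_nonneg]
  constructor
  · set Y : (ℕ → EuclideanSpace ℝ (Fin d)) → ℝ≥0∞ := fun ω => ∑ j, supNormSum (X j) ω with hY
    have hsup : ∀ ω, (⨆ (n : ℕ) (_ : 1 ≤ n), ENNReal.ofReal (rate n) *
        wassersteinDist 2 (multivariateGaussian m V) (plugInGaussian n ω)) ≤
          ENNReal.ofReal (Real.sqrt V.trace) * G * (Y ω + Y ω ^ 2) := by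
      intro ω
      refine iSup₂_le fun n hn => (rate_mul_wassersteinDist_le hn m hV ω).trans ?_
      rw [← hG, hmom]
      have h0 : 0 ≤ ∑ j, normSum (X j) n ω := Finset.sum_nonneg fun j _ => normSum_nonneg _ _ _
      have hle : ENNReal.ofReal (∑ j, normSum (X j) n ω) ≤ Y ω := by
        rw [ENNReal.ofReal_sum_of_nonneg fun j _ => normSum_nonneg _ _ _]
        exact Finset.sum_le_sum fun j _ =>
          le_iSup₂ (f := fun n (_ : 1 ≤ n) => ENNReal.ofReal (normSum (X j) n ω)) n hn
      rw [ENNReal.ofReal_add h0 (by positivity), ENNReal.ofReal_pow h0]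
      gcongr
    have hYmeas : ∀ j, Measurable fun ω => supNormSum (X j) ω ^ 4 := fun j =>
      (measurable_supNormSum (hXmeas j)).pow_const 4
    have hY4 : ∫⁻ ω, Y ω ^ 4 ∂μ ≤ N ^ 3 * (N * K) := by
      refine (lintegral_mono fun ω => ENNReal.sum_pow_four_le _).trans ?_
      rw [lintegral_const_mul _ (Finset.measurable_fun_sum _ fun j _ => hYmeas j),
        lintegral_finsetSum _ fun j _ => hYmeas j]
      gcongr
      refine (Finset.sum_le_card_nsmul _ _ (K : ℝ≥0∞) fun j _ => (hbd j).1).trans (le_of_eq ?_)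
      rw [nsmul_eq_mul, Finset.card_univ]
    have hYm : Measurable fun ω => Y ω ^ 4 :=
      (Finset.measurable_fun_sum _ fun j _ => measurable_supNormSum (hXmeas j)).pow_const 4
    calc _ ≤ ∫⁻ ω, ENNReal.ofReal V.trace * G ^ 2 * (4 * (1 + Y ω ^ 4)) ∂μ := by
          refine lintegral_mono fun ω => (pow_le_pow_left₀ zero_le (hsup ω) 2).trans ?_
          rw [mul_pow, mul_pow, hsq]
          gcongr
          exact ENNReal.add_sq_sq_le _
      _ = ENNReal.ofReal V.trace * G ^ 2 * (4 * (1 + ∫⁻ ω, Y ω ^ 4 ∂μ)) := by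
          rw [lintegral_const_mul _ ((hYm.const_add 1).const_mul 4),
            lintegral_const_mul _ (hYm.const_add 1), lintegral_add_left measurable_const,
            lintegral_const, measure_univ, mul_one]
      _ ≤ ENNReal.ofReal V.trace * G ^ 2 * (4 * (1 + N ^ 3 * (N * K))) := by gcongr
      _ = _ := by
          push_cast
          ring
  · filter_upwards [ae_all_iff.2 fun j => (hbd j).2] with ω hω
    refine limsup_le_of_le (h := ?_)
    filter_upwards [eventually_all.2 hω, eventually_ge_atTop 1] with n hn hn1
    refine (rate_mul_wassersteinDist_le hn1 m hV ω).trans ?_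
    have h0 : 0 ≤ ∑ j, normSum (X j) n ω := Finset.sum_nonneg fun j _ => normSum_nonneg _ _ _
    have hle : ∑ j, normSum (X j) n ω ≤ q := by
      refine (Finset.sum_le_card_nsmul _ _ (K : ℝ) fun j _ => hn j).trans (le_of_eq ?_)
      rw [nsmul_eq_mul, Finset.card_univ, hq]
      push_cast
      rfl
    rw [← hG, hmom, mul_assoc]
    push_cast
    have hq' : ENNReal.ofReal (∑ j, normSum (X j) n ω + (∑ j, normSum (X j) n ω) ^ 2) ≤
        (q : ℝ≥0∞) + (q : ℝ≥0∞) ^ 2 := by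
      rw [ENNReal.ofReal_add h0 (by positivity), ENNReal.ofReal_pow h0]
      have : ENNReal.ofReal (∑ j, normSum (X j) n ω) ≤ q := ENNReal.ofReal_le_of_le_toReal hle
      gcongr
    gcongr

open scoped Matrix.Norms.Frobenius in
-- Each diagonal entry is at most the Frobenius norm. This moves a `d`-dependent multiple of the
-- trace into the term carrying `K`.
theorem trace_le_mul_frobeniusNorm (V : Matrix (Fin d) (Fin d) ℝ) :
    V.trace ≤ d * frobeniusNorm V := by
  have hentry : ∀ k, V k k ≤ frobeniusNorm V := by
    intro k
    rw [frobeniusNorm, Matrix.frobenius_norm_def, ← Real.sqrt_eq_rpow]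
    refine Real.le_sqrt_of_sq_le ?_
    simp only [Real.rpow_ofNat, Real.norm_eq_abs, sq_abs]
    refine le_trans ?_ (Finset.single_le_sum (f := fun i => ∑ j, V i j ^ 2)
      (fun i _ => Finset.sum_nonneg fun j _ => sq_nonneg _) (Finset.mem_univ k))
    exact Finset.single_le_sum (f := fun j => V k j ^ 2) (fun j _ => sq_nonneg _)
      (Finset.mem_univ k)
  refine (Finset.sum_le_card_nsmul _ _ _ fun k _ => hentry k).trans (le_of_eq ?_)
  simp

end PlugIn

/-! ### Absorbing the constants -/

theorem mainTheorem2 :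
    ∃ cstar cast : ℝ, 0 < cstar ∧ 0 < cast ∧
      ∀ (d : ℕ), 1 ≤ d →
        ∀ (ε : ℝ), 0 < ε → ε ≤ ((2 * ((d : ℝ) + 1)) ^ d)⁻¹ →
          ∃ K H : ℝ, 0 < K ∧ 0 < H ∧
            ∀ (m₀ : EuclideanSpace ℝ (Fin d)) (V₀ : Matrix (Fin d) (Fin d) ℝ) (hV₀ : V₀.PosDef),
              (∫⁻ ω, (⨆ (n : ℕ) (_ : 1 ≤ n), ENNReal.ofReal (rate n) *
                    wassersteinDist 2 (multivariateGaussian m₀ V₀) (plugInGaussian n ω)) ^ 2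
                  ∂(Measure.infinitePi fun _ : ℕ => multivariateGaussian m₀ V₀)
                ≤ ENNReal.ofReal
                    ((cstar + rate d ^ 2 * ((d : ℝ) + 1)) * V₀.trace
                      + cast * K * frobeniusNorm V₀ + H)) ∧
              (∀ᵐ ω ∂(Measure.infinitePi fun _ : ℕ => multivariateGaussian m₀ V₀),
                limsup (fun n : ℕ => ENNReal.ofReal (rate n) *
                    wassersteinDist 2 (multivariateGaussian m₀ V₀) (plugInGaussian n ω)) atTop
                  ≤ ENNReal.ofReal
                    (Real.sqrt 2 * (sigmaMax hV₀.isHermitian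
                      + (d : ℝ) * Real.sqrt K * Real.sqrt V₀.trace))) := by
  refine ⟨1, 1, one_pos, one_pos, fun d hd ε _ _ => ?_⟩
  obtain ⟨A, B, hAB⟩ := exists_bound_plugInGaussian d
  have hA := A.coe_nonneg
  have hB := B.coe_nonneg
  have hd1 : (1 : ℝ) ≤ d := by exact_mod_cast hd
  -- In `K`, the summand `A d` absorbs `A tr V ≤ A d ‖V‖_F`, the summand `B²` ensures `B ≤ √K`, and
  -- `1` ensures positivity.
  refine ⟨A * d + B ^ 2 + 1, 1, by positivity, one_pos, fun m V hV => ?_⟩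
  obtain ⟨h1, h2⟩ := hAB m V hV
  have htr : 0 ≤ V.trace := hV.posSemidef.trace_nonneg
  constructor
  · refine h1.trans ?_
    rw [← ENNReal.ofReal_coe_nnreal, ← ENNReal.ofReal_mul htr]
    refine ENNReal.ofReal_le_ofReal ?_
    have hF := trace_le_mul_frobeniusNorm V
    have hF0 : 0 ≤ frobeniusNorm V := by
      have : 0 < (d : ℝ) := by linarith
      exact nonneg_of_mul_nonneg_right (htr.trans hF) this
    have h3 : 0 ≤ (1 + rate d ^ 2 * ((d : ℝ) + 1)) * V.trace := by positivity
    have h4 : V.trace * A ≤ d * frobeniusNorm V * A := by gcongr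
    nlinarith [mul_nonneg (add_nonneg (sq_nonneg (B : ℝ)) zero_le_one) hF0]
  · filter_upwards [h2] with ω hω
    refine hω.trans ?_
    rw [← ENNReal.ofReal_coe_nnreal, ← ENNReal.ofReal_mul (Real.sqrt_nonneg _)]
    refine ENNReal.ofReal_le_ofReal ?_
    have hsig : 0 ≤ sigmaMax hV.isHermitian := Real.sqrt_nonneg _
    have hK : (B : ℝ) ≤ Real.sqrt (A * d + B ^ 2 + 1) := by
      refine Real.le_sqrt_of_sq_le ?_
      have : 0 ≤ (A : ℝ) * d := by positivity
      linarith
    have hs2 : 1 ≤ Real.sqrt 2 := Real.one_le_sqrt.2 one_le_two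
    calc Real.sqrt V.trace * B ≤ 1 * (1 * Real.sqrt (A * d + B ^ 2 + 1) * Real.sqrt V.trace) := by
          rw [mul_comm]
          simp only [one_mul]
          gcongr
      _ ≤ Real.sqrt 2 * (d * Real.sqrt (A * d + B ^ 2 + 1) * Real.sqrt V.trace) := by gcongr
      _ ≤ _ := by
          gcongr
          linarith
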